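/- Let $k$ be a commutative ring and let $H$ be a Hopf algebra over $k$ with counit $\varepsilon$ and antipode $S$. Assume that $H$ is involutory, i.e. $S^2=\mathrm{id}$, and Frobenius over $k$, i.e. $H$ is finitely generated projective over $k$ and $H\cong H^*=\operatorname{Hom}_k(H,k)$ as left $H$-modules, where $(af)(x)=f(xa)$. Let $\mathfrak dH$ be the ideal $\langle\varepsilon,\int_H\rangle=\{\varepsilon(a)\mid a\in\int_H\}$ of $k$, where $\int_H=\{a\in H\mid ab=\varepsilon(b)a\text{ for all }b\in H\}$ is the $k$-module of right integrals of $H$ (the left integrals give the same ideal). Let $B$ be a right $H$-comodule algebra, that is, a $k$-algebra with a coassociative and counital coaction $\rho\colon B\to B\otimes_k H$ that is a homomorphism of $k$-algebras, and let $A=\{a\in B\mid\rho(a)=a\otimes 1\}$ be its subalgebra of coinvariants. Assume that $B/A$ is a right $H$-Galois extension, i.e. at least one of the two maps $B\otimes_A B\to B\otimes_k H$ given by $b\otimes c\mapsto(b\otimes1)\rho(c)$ and by $b\otimes c\mapsto\rho(b)(c\otimes1)$ is bijective. Assume further that (i) $A$ is commutative and has no idempotents other than $0$ and $1$, and (ii)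 there is a $k$-linear form $f\colon B\to k$ with $f(xy-yx)=0$ for all $x,y\in B$ and $f(1)=1$. Then every finitely generated projective left $B$-module $M$ is, by restriction, a finitely generated projective $A$-module of constant rank, and $\operatorname{rank}_A(M)\cdot1\in\mathfrak dH$. That is, there is an integer $n\ge0$ such that for every prime ideal $\mathfrak p$ of $A$ the free $A_{\mathfrak p}$-module $M_{\mathfrak p}$ has rank $n$, and $n\cdot 1_k\in\mathfrak dH$. -/

import Mathlib

open scoped TensorProduct

namespace HopfGalois

noncomputable section

universe u v w x

section Frobenius

variable (k : Type u) [CommRing k]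

/-- A `k`-algebra `H` is Frobenius: it is finitely generated projective over `k`, and `H` is
isomorphic to `H* = Hom_k(H, k)` as a left `H`-module, where `(a • f) x = f (x * a)`. -/
def IsFrobenius (H : Type v) [Ring H] [Algebra k H] : Prop :=
  Module.Finite k H ∧ Module.Projective k H ∧
    ∃ e : H ≃ₗ[k] Module.Dual k H, ∀ a b x : H, e (a * b) x = e b (x * a)

/-- A `k`-linear form `f` on `B` is a trace form: it vanishes on all commutators `x * y - y * x`. -/
def IsTraceForm {k : Type u} [CommRing k] {B : Type w} [Ring B] [Algebra k B]
    (f : B →ₗ[k] k) : Prop :=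
  ∀ x y : B, f (x * y - y * x) = 0

end Frobenius

section Hopf

variable (k : Type u) [CommRing k] (H : Type v) [Ring H] [HopfAlgebra k H]

/-- `H` is involutory: the antipode squares to the identity. -/
def IsInvolutory : Prop :=
  ∀ h : H, HopfAlgebra.antipode k (HopfAlgebra.antipode k h) = h

/-- The right integrals `{a ∈ H | a * b = ε(b) a for all b ∈ H}`. -/
def rightIntegrals : Submodule k H where
  carrier := {a | ∀ b : H, a * b = Coalgebra.counit (R := k) b • a}
  add_mem' := by
    intro a a' ha ha' b
    rw [add_mul, ha b, ha' b, smul_add]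
  zero_mem' := by
    intro b
    rw [zero_mul, smul_zero]
  smul_mem' := by
    intro c a ha b
    rw [smul_mul_assoc, ha b, smul_comm]

/-- The left integrals `{a ∈ H | b * a = ε(b) a for all b ∈ H}`. -/
def leftIntegrals : Submodule k H where
  carrier := {a | ∀ b : H, b * a = Coalgebra.counit (R := k) b • a}
  add_mem' := by
    intro a a' ha ha' b
    rw [mul_add, ha b, ha' b, smul_add]
  zero_mem' := by
    intro b
    rw [mul_zero, smul_zero]
  smul_mem' := by
    intro c a ha b
    rw [mul_smul_comm, ha b, smul_comm]

/-- The ideal `⟨ε, ∫⟩ = {ε(a) | a a right integral of H}` of `k`. -/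
def integralIdeal : Ideal k :=
  Submodule.map (Coalgebra.counit (R := k) (A := H)) (rightIntegrals k H)

/-- Left and right integrals define the same ideal (for involutory `H`). -/
theorem integralIdeal_eq_left (hS : IsInvolutory k H) :
    integralIdeal k H =
      Submodule.map (Coalgebra.counit (R := k) (A := H)) (leftIntegrals k H) := by
  apply le_antisymm
  · rintro _ ⟨a, ha, rfl⟩
    refine ⟨HopfAlgebra.antipode k a, fun b => ?_, HopfAlgebra.counit_antipode a⟩
    have h := congrArg (HopfAlgebra.antipode k) (ha (HopfAlgebra.antipode k b))
    rwa [HopfAlgebra.antipode_mul_antidistrib, hS b, map_smul,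
      HopfAlgebra.counit_antipode] at h
  · rintro _ ⟨a, ha, rfl⟩
    refine ⟨HopfAlgebra.antipode k a, fun b => ?_, HopfAlgebra.counit_antipode a⟩
    have h := congrArg (HopfAlgebra.antipode k) (ha (HopfAlgebra.antipode k b))
    rwa [HopfAlgebra.antipode_mul_antidistrib, hS b, map_smul,
      HopfAlgebra.counit_antipode] at h

/-- A right `H`-comodule algebra structure on the `k`-algebra `B`: a coassociative and counital
coaction `ρ : B → B ⊗ H` that is a homomorphism of `k`-algebras. -/
structure RightComoduleAlgebra (B : Type w) [Ring B] [Algebra k B] where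
  /-- the coaction -/
  coaction : B →ₐ[k] B ⊗[k] H
  /-- `(ρ ⊗ id) ∘ ρ = (id ⊗ Δ) ∘ ρ` -/
  coassoc : ∀ b : B,
    TensorProduct.assoc k B H H (coaction.toLinearMap.rTensor H (coaction b)) =
      (Coalgebra.comul (R := k) (A := H)).lTensor B (coaction b)
  /-- `(id ⊗ ε) ∘ ρ = id` -/
  counit : ∀ b : B,
    (Coalgebra.counit (R := k) (A := H)).lTensor B (coaction b) = b ⊗ₜ[k] (1 : k)

end Hopf

section Balanced

variable {k : Type u} [CommRing k] {B : Type w} [Ring B] [Algebra k B]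

/-- The submodule of `B ⊗[k] B` spanned by the elements `b a ⊗ c - b ⊗ a c` with `a ∈ A`. -/
def balancedRelations (A : Subalgebra k B) : Submodule k (B ⊗[k] B) :=
  Submodule.span k {t | ∃ b a c : B, a ∈ A ∧ t = (b * a) ⊗ₜ[k] c - b ⊗ₜ[k] (a * c)}

/-- The tensor product `B ⊗_A B` over a subalgebra `A` that need not be central in `B`. -/
abbrev BalancedTensor (A : Subalgebra k B) : Type w :=
  (B ⊗[k] B) ⧸ balancedRelations A

end Balanced

namespace RightComoduleAlgebra

variable {k : Type u} [CommRing k] {H : Type v} [Ring H] [HopfAlgebra k H]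
  {B : Type w} [Ring B] [Algebra k B] (ρ : RightComoduleAlgebra k H B)

/-- The subalgebra `{a ∈ B | ρ(a) = a ⊗ 1}` of coinvariants. -/
def coinvariants : Subalgebra k B :=
  AlgHom.equalizer ρ.coaction (Algebra.TensorProduct.includeLeft : B →ₐ[k] B ⊗[k] H)

theorem mem_coinvariants (a : B) : a ∈ ρ.coinvariants ↔ ρ.coaction a = a ⊗ₜ[k] (1 : H) :=
  Iff.rfl

/-- `b ⊗ c ↦ (b ⊗ 1) ρ(c)` on `B ⊗[k] B`. -/
def preCanLeft : B ⊗[k] B →ₗ[k] B ⊗[k] H :=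
  TensorProduct.lift ((LinearMap.mul k (B ⊗[k] H)).compl₁₂
    (Algebra.TensorProduct.includeLeft : B →ₐ[k] B ⊗[k] H).toLinearMap ρ.coaction.toLinearMap)

/-- `b ⊗ c ↦ ρ(b) (c ⊗ 1)` on `B ⊗[k] B`. -/
def preCanRight : B ⊗[k] B →ₗ[k] B ⊗[k] H :=
  TensorProduct.lift ((LinearMap.mul k (B ⊗[k] H)).compl₁₂
    ρ.coaction.toLinearMap (Algebra.TensorProduct.includeLeft : B →ₐ[k] B ⊗[k] H).toLinearMap)

theorem preCanLeft_tmul (b c : B) :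
    ρ.preCanLeft (b ⊗ₜ[k] c) = (b ⊗ₜ[k] (1 : H)) * ρ.coaction c := rfl

theorem preCanRight_tmul (b c : B) :
    ρ.preCanRight (b ⊗ₜ[k] c) = ρ.coaction b * (c ⊗ₜ[k] (1 : H)) := rfl

/-- The canonical map `B ⊗_A B → B ⊗ H`, `b ⊗ c ↦ (b ⊗ 1) ρ(c)`, with `A` the coinvariants. -/
def canLeft : BalancedTensor ρ.coinvariants →ₗ[k] B ⊗[k] H :=
  Submodule.liftQ _ ρ.preCanLeft <| by
    refine Submodule.span_le.mpr ?_
    rintro _ ⟨b, a, c, ha, rfl⟩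
    rw [mem_coinvariants] at ha
    simp [preCanLeft_tmul, ha, ← mul_assoc]

/-- The canonical map `B ⊗_A B → B ⊗ H`, `b ⊗ c ↦ ρ(b) (c ⊗ 1)`, with `A` the coinvariants. -/
def canRight : BalancedTensor ρ.coinvariants →ₗ[k] B ⊗[k] H :=
  Submodule.liftQ _ ρ.preCanRight <| by
    refine Submodule.span_le.mpr ?_
    rintro _ ⟨b, a, c, ha, rfl⟩
    rw [mem_coinvariants] at ha
    simp [preCanRight_tmul, ha, mul_assoc]

/-- `B/A`, with `A` the coinvariants, is a right `H`-Galois extension: one of the two canonical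
maps is bijective (the two conditions are equivalent when the antipode is bijective). -/
def IsGaloisExtension : Prop :=
  Function.Bijective ρ.canLeft ∨ Function.Bijective ρ.canRight

end RightComoduleAlgebra

/-- The `R`-module `M` is finitely generated projective of constant rank `n`: for every prime `p`,
the `R_p`-module `M_p` (which is then free) has rank `n`. -/
def HasConstantRank (R : Type u) [CommRing R] (M : Type x) [AddCommGroup M] [Module R M]
    (n : ℕ) : Prop :=
  Module.Finite R M ∧ Module.Projective R M ∧
    ∀ p : PrimeSpectrum R, Module.rankAtStalk (R := R) M p = n

end

end HopfGalois

open scoped IsMulCommutative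

/-!
Choose a left integral `t` of `H` and a left integral `lam` of the dual of `H` with `lam ⇀ t = 1`.
If `∑ ρ(lᵢ) (rᵢ ⊗ 1) = 1 ⊗ t`, then `E(b) = ∑ lam(b₁) b₀` is a Frobenius homomorphism from `B` to
the coinvariants `A`, with `∑ E(b lᵢ) rᵢ = b`. Hence a dual basis `u`, `φ` of `M` over `B` gives one
over `A`, and the rank of `M` over `A` is `∑ E(rᵢ c lᵢ)`, where `c = ∑ φⱼ(uⱼ)`. A trace form `f`
sees the `lᵢ` and `rᵢ` only through `∑ lᵢ₀ rᵢ₀ ⊗ rᵢ₁ ⊗ lᵢ₁`, which equals `1 ⊗ S(t₁) ⊗ t₂`; the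
orthogonality relation `∑ lam(S(t₁) h t₂) = ε(t) lam(S(h))` then shows that `f` maps the rank to
`ε(t) f(∑ lam(S(c₁)) c₀)`. Here the rank is an element of `A`, namely the trace of the identity of
`M`; for connected `A` it is an integer `n`, and `f(n) = n`.
-/

namespace HopfGalois

open Coalgebra HopfAlgebra TensorProduct

section DualBasis

/-- Finite families `u` in `M` and `φ` in the dual of `M` form a (projective) dual basis of the
left module `M`: every `m` is `∑ φ s m • u s`. Neither independence nor uniqueness is required. -/
def IsDualBasis {R M σ : Type*} [Semiring R] [AddCommMonoid M] [Module R M] [Fintype σ]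
    (u : σ → M) (φ : σ → M →ₗ[R] R) : Prop :=
  ∀ m, ∑ s, φ s m • u s = m

theorem exists_isDualBasis (R M : Type*) [Semiring R] [AddCommMonoid M] [Module R M]
    [Module.Finite R M] [Module.Projective R M] :
    ∃ (n : ℕ) (u : Fin n → M) (φ : Fin n → M →ₗ[R] R), IsDualBasis u φ := by
  obtain ⟨n, p, i, -, -, hpi⟩ := Module.Finite.exists_comp_eq_id_of_projective R M
  refine ⟨n, fun s => p (Pi.single s 1), fun s => LinearMap.proj s ∘ₗ i, fun m => ?_⟩
  conv_rhs => rw [← LinearMap.id_apply (R := R) m, ← hpi, LinearMap.comp_apply,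
    pi_eq_sum_univ' (i m), map_sum]
  refine Finset.sum_congr rfl fun s _ => ?_
  rw [← map_smul]
  rfl

namespace IsDualBasis

section Semiring

variable {R M σ : Type*} [Semiring R] [AddCommMonoid M] [Module R M] [Fintype σ]
  {u : σ → M} {φ : σ → M →ₗ[R] R}

theorem linearCombination_comp_pi (h : IsDualBasis u φ) :
    Fintype.linearCombination R u ∘ₗ LinearMap.pi φ = LinearMap.id :=
  LinearMap.ext fun m => by simp [Fintype.linearCombination_apply, h m]

theorem finite (h : IsDualBasis u φ) : Module.Finite R M :=
  .of_surjective (Fintype.linearCombination R u)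
    (LinearMap.surjective_of_comp_eq_id _ _ h.linearCombination_comp_pi)

theorem projective (h : IsDualBasis u φ) : Module.Projective R M :=
  .of_split _ _ h.linearCombination_comp_pi

/-- The hypothesis `hE` says that `E`, `l`, `r` form a Frobenius system of `R` over `A`. -/
theorem restrictScalars {A ι : Type*} [Semiring A] [Module A R] [IsScalarTower A R R] [Fintype ι]
    [Module A M] [IsScalarTower A R M] (h : IsDualBasis u φ) (E : R →ₗ[A] A) {l r : ι → R}
    (hE : ∀ b, ∑ i, E (b * l i) • r i = b) :
    IsDualBasis (fun s : σ × ι => r s.2 • u s.1)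
      (fun s => E ∘ₗ LinearMap.mulRight A (l s.2) ∘ₗ (φ s.1).restrictScalars A) := fun m => by
  conv_rhs => rw [← h m]
  rw [Fintype.sum_prod_type]
  refine Finset.sum_congr rfl fun s _ => ?_
  conv_rhs => rw [← hE (φ s m), Finset.sum_smul]
  simp

end Semiring

theorem baseChange {A M σ : Type*} [CommSemiring A] [AddCommMonoid M] [Module A M] [Fintype σ]
    {u : σ → M} {φ : σ → M →ₗ[A] A} (L : Type*) [CommSemiring L] [Algebra A L]
    (h : IsDualBasis u φ) :
    IsDualBasis (fun s => (1 : L) ⊗ₜ[A] u s) (fun s => Module.Dual.baseChange L (φ s)) := by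
  intro m
  induction m with
  | zero => simp
  | tmul x y =>
    conv_rhs => rw [← h y, tmul_sum]
    simp [smul_tmul']
  | add x y hx hy =>
    simp only [map_add, add_smul, Finset.sum_add_distrib, hx, hy]

theorem sum_eq_finrank {A M σ : Type*} [CommRing A] [AddCommGroup M] [Module A M]
    [Module.Free A M] [Fintype σ] {u : σ → M} {φ : σ → M →ₗ[A] A} (h : IsDualBasis u φ) :
    ∑ s, φ s (u s) = (Module.finrank A M : A) := by
  have := h.finite
  have hid : (LinearMap.id : M →ₗ[A] M) = ∑ s, (φ s).smulRight (u s) :=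
    LinearMap.ext fun m => by simp [LinearMap.sum_apply, h m]
  rw [← LinearMap.trace_id, hid, map_sum]
  simp

end IsDualBasis

end DualBasis

section RankElement

variable (A : Type*) [CommRing A] (M : Type*) [AddCommGroup M] [Module A M]

/-- The element `a` of `A` is the rank of the module `M`, regarded as a locally constant function
on the spectrum of `A`: its image in each local ring is the rank of `M` there. -/
def IsRankElement (a : A) : Prop :=
  ∀ p : PrimeSpectrum A, algebraMap A (Localization.AtPrime p.asIdeal) a =
    (Module.rankAtStalk (R := A) M p : Localization.AtPrime p.asIdeal)

variable {A M}

theorem IsDualBasis.isRankElement {σ : Type*} [Fintype σ] {u : σ → M} {φ : σ → M →ₗ[A] A}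
    (h : IsDualBasis u φ) : IsRankElement A M (∑ s, φ s (u s)) := by
  intro p
  obtain ⟨_, _⟩ := h.finite, h.projective
  let L := Localization.AtPrime p.asIdeal
  have : Module.Free L (L ⊗[A] M) := Module.free_of_flat_of_isLocalRing
  rw [Module.rankAtStalk_eq_finrank_tensorProduct, ← (h.baseChange L).sum_eq_finrank]
  simp [Algebra.algebraMap_eq_smul_one]

theorem preconnectedSpace_primeSpectrum (hA : ∀ e : A, IsIdempotentElem e → e = 0 ∨ e = 1) :
    PreconnectedSpace (PrimeSpectrum A) := by
  rw [preconnectedSpace_iff_clopen]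
  intro s hs
  obtain ⟨e, he, rfl⟩ := PrimeSpectrum.isClopen_iff.mp hs
  rcases hA e he with rfl | rfl <;> simp

theorem IsRankElement.exists_hasConstantRank [Module.Finite A M] [Module.Projective A M]
    (hA : ∀ e : A, IsIdempotentElem e → e = 0 ∨ e = 1) {a : A} (ha : IsRankElement A M a) :
    ∃ n : ℕ, a = n ∧ HasConstantRank A M n := by
  have := preconnectedSpace_primeSpectrum hA
  have := Module.finitePresentation_of_projective A M
  obtain ⟨n, hn⟩ : ∃ n : ℕ, ∀ p, Module.rankAtStalk (R := A) M p = n := by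
    rcases isEmpty_or_nonempty (PrimeSpectrum A) with hE | ⟨⟨q⟩⟩
    · exact ⟨0, hE.elim⟩
    · exact ⟨_, fun p =>
        Module.isLocallyConstant_rankAtStalk.apply_eq_of_preconnectedSpace p q⟩
  refine ⟨n, sub_eq_zero.mp (eq_zero_of_localization _ fun J hJ => ?_), ‹_›, ‹_›, hn⟩
  have := ha ⟨J, hJ.isPrime⟩
  rwa [map_sub, map_natCast, sub_eq_zero, ← hn ⟨J, hJ.isPrime⟩]

end RankElement

section Slice

variable {k : Type*} [CommSemiring k]

section Module

variable {N P Q : Type*} [AddCommMonoid N] [Module k N] [AddCommMonoid P] [Module k P]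
  [AddCommMonoid Q] [Module k Q]

/-- The slice map: `slice φ` contracts the right leg of a tensor with the linear form `φ`. -/
noncomputable def slice : Module.Dual k P →ₗ[k] N ⊗[k] P →ₗ[k] N :=
  (LinearMap.lTensorHom N).compr₂ (TensorProduct.rid k N).toLinearMap

@[simp]
theorem slice_tmul (φ : Module.Dual k P) (n : N) (p : P) : slice φ (n ⊗ₜ[k] p) = φ p • n := by
  simp [slice]

theorem map_slice (g : N →ₗ[k] Q) (φ : Module.Dual k P) (X : N ⊗[k] P) :
    g (slice φ X) = slice φ (g.rTensor P X) := by
  induction X with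
  | zero => simp
  | tmul x y => simp
  | add x y hx hy => simp only [map_add, hx, hy]

theorem slice_lTensor (φ : Module.Dual k Q) (g : P →ₗ[k] Q) (X : N ⊗[k] P) :
    slice φ (g.lTensor N X) = slice (φ ∘ₗ g) X := by
  induction X with
  | zero => simp
  | tmul x y => simp
  | add x y hx hy => simp only [map_add, hx, hy]

theorem slice_eq_lTensor_slice_assoc (φ : Module.Dual k Q) (X : (N ⊗[k] P) ⊗[k] Q) :
    slice φ X = (slice φ).lTensor N (TensorProduct.assoc k N P Q X) := by
  suffices slice φ = (slice φ).lTensor N ∘ₗ (TensorProduct.assoc k N P Q).toLinearMap from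
    LinearMap.congr_fun this X
  ext
  simp

theorem lTensor_smulRight (φ : Module.Dual k P) (q : Q) (X : N ⊗[k] P) :
    (φ.smulRight q).lTensor N X = slice φ X ⊗ₜ[k] q := by
  induction X with
  | zero => simp
  | tmul x y => simp [smul_tmul']
  | add x y hx hy => simp only [map_add, add_tmul, hx, hy]

end Module

variable {B H : Type*} [Semiring B] [Algebra k B] [Semiring H] [Algebra k H]

theorem slice_tmul_mul (φ : Module.Dual k H) (b : B) (h : H) (X : B ⊗[k] H) :
    slice φ ((b ⊗ₜ[k] h) * X) = b * slice (φ ∘ₗ LinearMap.mulLeft k h) X := by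
  induction X with
  | zero => simp
  | tmul x y => simp
  | add x y hx hy => simp only [mul_add, map_add, hx, hy]

theorem slice_mul_tmul (φ : Module.Dual k H) (b : B) (h : H) (X : B ⊗[k] H) :
    slice φ (X * (b ⊗ₜ[k] h)) = slice (φ ∘ₗ LinearMap.mulRight k h) X * b := by
  induction X with
  | zero => simp
  | tmul x y => simp
  | add x y hx hy => simp only [add_mul, map_add, hx, hy]

end Slice

section Legs

variable {k : Type*} [CommRing k] {H B : Type*} [Ring H] [Algebra k H] [Ring B] [Algebra k B]

variable (k H B) in
/-- The embedding `b ⊗ h ↦ b ⊗ (h ⊗ 1)` of `B ⊗ H` into the first two legs of `B ⊗ H ⊗ H`. -/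
noncomputable def leg12 : B ⊗[k] H →ₐ[k] B ⊗[k] (H ⊗[k] H) :=
  Algebra.TensorProduct.map (AlgHom.id k B) Algebra.TensorProduct.includeLeft

variable (k H B) in
/-- The embedding `b ⊗ h ↦ b ⊗ (1 ⊗ h)` of `B ⊗ H` into the outer legs of `B ⊗ H ⊗ H`. -/
noncomputable def leg13 : B ⊗[k] H →ₐ[k] B ⊗[k] (H ⊗[k] H) :=
  Algebra.TensorProduct.map (AlgHom.id k B) Algebra.TensorProduct.includeRight

@[simp]
theorem leg12_tmul (b : B) (h : H) : leg12 k H B (b ⊗ₜ h) = b ⊗ₜ (h ⊗ₜ 1) := rfl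

@[simp]
theorem leg13_tmul (b : B) (h : H) : leg13 k H B (b ⊗ₜ h) = b ⊗ₜ (1 ⊗ₜ h) := rfl

/-- `X` and `Z` enter the right-hand side only through `leg13 Z * leg12 X`, so this may be summed
over all the pairs of a Frobenius system at once. -/
theorem IsTraceForm.apply_slice_mul_tmul_mul {f : B →ₗ[k] k} (hf : IsTraceForm f)
    (lam : Module.Dual k H) (p : B) (q : H) (X Z : B ⊗[k] H) :
    f (slice lam (X * (p ⊗ₜ[k] q) * Z)) =
      (LinearMap.mul' k k ∘ₗ TensorProduct.map (f ∘ₗ LinearMap.mulRight k p)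
        (lam ∘ₗ LinearMap.mul' k H ∘ₗ (LinearMap.mulRight k q).rTensor H))
          (leg13 k H B Z * leg12 k H B X) := by
  induction X with
  | zero => simp
  | tmul r u =>
    induction Z with
    | zero => simp
    | tmul l v =>
      have hcomm : f (r * (p * l)) = f (l * (r * p)) := by
        rw [← mul_assoc, ← sub_eq_zero, ← map_sub, hf]
      simp [hcomm, mul_assoc, mul_comm]
    | add x y hx hy => simp only [add_mul, mul_add, map_add, hx, hy]
  | add x y hx hy => simp only [add_mul, mul_add, map_add, hx, hy]

end Legs

namespace RightComoduleAlgebra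

variable {k : Type*} [CommRing k] {H : Type*} [Ring H] [HopfAlgebra k H]
  {B : Type*} [Ring B] [Algebra k B]

section DualAct

variable (ρ : RightComoduleAlgebra k H B)

variable (k H) in
/-- The Hopf algebra `H` as a right comodule algebra over itself, by its comultiplication. -/
def regular : RightComoduleAlgebra k H H where
  coaction := Bialgebra.comulAlgHom k H
  coassoc := Coalgebra.coassoc_apply
  counit := Coalgebra.lTensor_counit_comul

@[simp]
theorem regular_coaction (h : H) : (regular k H).coaction h = comul (R := k) h := rfl

theorem lTensor_assoc_rTensor_coaction {P : Type*} [AddCommGroup P] [Module k P]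
    (m : H ⊗[k] H →ₗ[k] P) (b : B) :
    m.lTensor B (TensorProduct.assoc k B H H
        (ρ.coaction.toLinearMap.rTensor H (ρ.coaction b))) =
      (m ∘ₗ comul).lTensor B (ρ.coaction b) := by
  rw [ρ.coassoc, LinearMap.lTensor_comp_apply]

/-- The action `φ ⇀ b = ∑ φ(b₁) b₀` on a right comodule algebra of the dual of `H`. -/
noncomputable def dualAct : Module.Dual k H →ₗ[k] B →ₗ[k] B :=
  slice.compl₂ ρ.coaction.toLinearMap

theorem dualAct_apply (φ : Module.Dual k H) (b : B) :
    ρ.dualAct φ b = slice φ (ρ.coaction b) := rfl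

theorem coaction_dualAct (φ : Module.Dual k H) (b : B) :
    ρ.coaction (ρ.dualAct φ b) = ((regular k H).dualAct φ).lTensor B (ρ.coaction b) := by
  rw [dualAct_apply, ← AlgHom.toLinearMap_apply, map_slice, slice_eq_lTensor_slice_assoc,
    lTensor_assoc_rTensor_coaction]
  rfl

theorem dualAct_dualAct (ψ φ : Module.Dual k H) (b : B) :
    ρ.dualAct ψ (ρ.dualAct φ b) = ρ.dualAct (ψ ∘ₗ (regular k H).dualAct φ) b := by
  rw [dualAct_apply, coaction_dualAct, slice_lTensor, dualAct_apply]

theorem dualAct_counit (b : B) : ρ.dualAct Coalgebra.counit b = b := by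
  rw [dualAct_apply, ← LinearMap.id_comp Coalgebra.counit, ← slice_lTensor, ρ.counit]
  simp

theorem dualAct_one (φ : Module.Dual k H) : ρ.dualAct φ 1 = φ 1 • (1 : B) := by
  rw [dualAct_apply, map_one, Algebra.TensorProduct.one_def, slice_tmul]

end DualAct

theorem counit_dualAct (φ : Module.Dual k H) (h : H) :
    Coalgebra.counit (R := k) ((regular k H).dualAct φ h) = φ h := by
  rw [dualAct_apply, map_slice, regular_coaction, rTensor_counit_comul, slice_tmul, smul_eq_mul,
    mul_one]

theorem dualAct_eq_sum (φ : Module.Dual k H) {h : H} {ι : Type*} (r : Coalgebra.Repr k h ι) :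
    (regular k H).dualAct φ h = ∑ i ∈ r.index, φ (r.right i) • r.left i := by
  simp [dualAct_apply, ← r.eq]

end RightComoduleAlgebra

section HopfIdentities

variable {k : Type*} [CommRing k] {H : Type*} [Ring H] [HopfAlgebra k H]

theorem rTensor_assoc_symm_lTensor_comul {C P : Type*} [AddCommGroup C] [Module k C]
    [Coalgebra k C] [AddCommGroup P] [Module k P] {m : C ⊗[k] C →ₗ[k] P} {p : P}
    (hm : ∀ z : C, m (comul z) = counit (R := k) z • p) (c : C) :
    m.rTensor C ((TensorProduct.assoc k C C C).symm (comul.lTensor C (comul c))) = p ⊗ₜ c := by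
  have hm' : m ∘ₗ comul = LinearMap.toSpanSingleton k P p ∘ₗ counit := LinearMap.ext hm
  rw [coassoc_symm_apply, ← LinearMap.rTensor_comp_apply, hm', LinearMap.rTensor_comp_apply,
    rTensor_counit_comul]
  simp

theorem sum_antipode_tmul_one_mul_comul {h : H} {ι : Type*} (r : Coalgebra.Repr k h ι) :
    ∑ i ∈ r.index, (antipode k (r.left i) ⊗ₜ[k] (1 : H)) * comul (R := k) (r.right i) =
      1 ⊗ₜ h := by
  have hmul (u : H) (X : H ⊗[k] H) : (antipode k u ⊗ₜ[k] (1 : H)) * X =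
      (LinearMap.mul' k H ∘ₗ (antipode k).rTensor H).rTensor H
        ((TensorProduct.assoc k H H H).symm (u ⊗ₜ X)) := by
    induction X with
    | zero => simp
    | tmul x y => simp
    | add x y hx hy => rw [mul_add, hx, hy, tmul_add, map_add, map_add]
  rw [← rTensor_assoc_symm_lTensor_comul
    (m := LinearMap.mul' k H ∘ₗ (antipode k).rTensor H) (fun z => by
      simp [Algebra.algebraMap_eq_smul_one]) h]
  conv_rhs => rw [← r.eq]
  simp [hmul]

theorem one_tmul_mul_comul_of_mem_leftIntegrals {t : H} (ht : t ∈ leftIntegrals k H) (h : H) :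
    ((1 : H) ⊗ₜ[k] h) * comul (R := k) t = (antipode k h ⊗ₜ[k] (1 : H)) * comul (R := k) t := by
  let r := Coalgebra.Repr.arbitrary k h
  calc ((1 : H) ⊗ₜ[k] h) * comul (R := k) t
    _ = ∑ i ∈ r.index, (antipode k (r.left i) ⊗ₜ[k] (1 : H)) * comul (R := k) (r.right i * t) := by
      simp only [Bialgebra.comul_mul, ← mul_assoc, ← Finset.sum_mul,
        sum_antipode_tmul_one_mul_comul]
    _ = antipode k (∑ i ∈ r.index, counit (R := k) (r.right i) • r.left i) ⊗ₜ[k] (1 : H) *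
        comul (R := k) t := by
      simp only [ht _, map_smul, map_sum, mul_smul_comm, sum_tmul, Finset.sum_mul, ← smul_tmul',
        smul_mul_assoc]
    _ = (antipode k h ⊗ₜ[k] (1 : H)) * comul (R := k) t := by
      rw [← RightComoduleAlgebra.dualAct_eq_sum, RightComoduleAlgebra.dualAct_counit]

theorem antipode_mul_dualAct {t : H} (ht : t ∈ leftIntegrals k H) (φ : Module.Dual k H) (x : H) :
    antipode k x * (RightComoduleAlgebra.regular k H).dualAct φ t =
      (RightComoduleAlgebra.regular k H).dualAct (φ ∘ₗ LinearMap.mulLeft k x) t := by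
  have := congrArg (slice φ) (one_tmul_mul_comul_of_mem_leftIntegrals ht x)
  rw [slice_tmul_mul, slice_tmul_mul, one_mul, LinearMap.mulLeft_one, LinearMap.comp_id] at this
  exact this.symm

theorem sum_antipode_right_mul_left (hS : IsInvolutory k H) {z : H} {ι : Type*}
    (r : Coalgebra.Repr k z ι) :
    ∑ i ∈ r.index, antipode k (r.right i) * r.left i = counit (R := k) z • (1 : H) := by
  have := congrArg (antipode k) (sum_antipode_mul_eq_smul (R := k) r)
  simpa [antipode_mul_antidistrib, hS _] using this

variable (k H) in
/-- The linear map `u ⊗ v ↦ ∑ S(v₁) u ⊗ v₂`. -/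
noncomputable def antipodeComulMul : H ⊗[k] H →ₗ[k] H ⊗[k] H :=
  lift ((LinearMap.mul k (H ⊗[k] H)).compl₁₂
    ((antipode k).rTensor H ∘ₗ (comul : H →ₗ[k] H ⊗[k] H))
    (Algebra.TensorProduct.includeLeft : H →ₐ[k] H ⊗[k] H).toLinearMap).flip

theorem antipodeComulMul_tmul (u v : H) :
    antipodeComulMul k H (u ⊗ₜ v) =
      (antipode k).rTensor H (comul (R := k) v) * (u ⊗ₜ[k] (1 : H)) := rfl

theorem antipodeComulMul_comul (hS : IsInvolutory k H) (h : H) :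
    antipodeComulMul k H (comul (R := k) h) = 1 ⊗ₜ h := by
  let m := LinearMap.mul' k H ∘ₗ (antipode k).rTensor H ∘ₗ (TensorProduct.comm k H H).toLinearMap
  have hm (z : H) : m (comul z) = counit (R := k) z • (1 : H) := by
    let r := Coalgebra.Repr.arbitrary k z
    rw [← sum_antipode_right_mul_left hS r, ← r.eq]
    simp [m]
  have hmul (u : H) (X : H ⊗[k] H) : (antipode k).rTensor H X * (u ⊗ₜ[k] (1 : H)) =
      m.rTensor H ((TensorProduct.assoc k H H H).symm (u ⊗ₜ X)) := by
    induction X with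
    | zero => simp
    | tmul x y => simp [m]
    | add x y hx hy => rw [map_add, add_mul, hx, hy, tmul_add, map_add, map_add]
  let r := Coalgebra.Repr.arbitrary k h
  rw [← rTensor_assoc_symm_lTensor_comul hm h, ← r.eq]
  simp [antipodeComulMul_tmul, hmul]

end HopfIdentities

section Integrals

open RightComoduleAlgebra

variable {k : Type*} [CommRing k] {H : Type*} [Ring H] [HopfAlgebra k H]

/-- A left integral in the dual of `H`: a linear form `lam` with `∑ lam(h₂) h₁ = lam(h) 1`. -/
def IsLeftCointegral (lam : Module.Dual k H) : Prop :=
  ∀ h, (regular k H).dualAct lam h = lam h • (1 : H)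

theorem IsFrobenius.exists_leftIntegral_apply_eq_one (hF : IsFrobenius k H) :
    ∃ t ∈ leftIntegrals k H, ∃ β : Module.Dual k H, β t = 1 := by
  obtain ⟨-, -, e, he⟩ := hF
  obtain ⟨t, ht⟩ := e.surjective (counit : H →ₗ[k] k)
  refine ⟨t, fun b => e.injective (LinearMap.ext fun x => ?_), e 1, ?_⟩
  · rw [he, ht, map_smul, LinearMap.smul_apply, ht, Bialgebra.counit_mul, smul_eq_mul, mul_comm]
  · rw [← one_mul t, ← he, mul_one, ht, Bialgebra.counit_one]

theorem IsDualBasis.sum_antipode_mul_dualAct (hS : IsInvolutory k H) {σ : Type*} [Fintype σ]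
    {v : σ → H} {g : σ → Module.Dual k H} (h : IsDualBasis v g) (z : H) :
    ∑ s, antipode k (v s) * (regular k H).dualAct (g s) z = counit (R := k) z • (1 : H) := by
  let r := Coalgebra.Repr.arbitrary k z
  calc ∑ s, antipode k (v s) * (regular k H).dualAct (g s) z
    _ = ∑ i ∈ r.index, antipode k (∑ s, g s (r.right i) • v s) * r.left i := by
      simp only [dualAct_eq_sum _ r, Finset.mul_sum, map_sum, map_smul, Finset.sum_mul,
        mul_smul_comm, smul_mul_assoc]
      exact Finset.sum_comm
    _ = counit (R := k) z • (1 : H) := by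
      simp only [h _, sum_antipode_right_mul_left hS]

theorem surjective_flip_dualAct [Module.Finite k H] [Module.Projective k H]
    (hS : IsInvolutory k H) {t : H} (ht : t ∈ leftIntegrals k H) {β : Module.Dual k H}
    (hβ : β t = 1) : Function.Surjective ((regular k H).dualAct.flip t) := by
  let I := LinearMap.range ((regular k H).dualAct.flip t)
  have mul_mem (x : H) {z : H} (hz : z ∈ I) : x * z ∈ I := by
    obtain ⟨φ, rfl⟩ := hz
    exact ⟨φ ∘ₗ LinearMap.mulLeft k (antipode k x), by
      rw [LinearMap.flip_apply, ← antipode_mul_dualAct ht, hS, LinearMap.flip_apply]⟩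
  have dualAct_mem (ψ : Module.Dual k H) {z : H} (hz : z ∈ I) : (regular k H).dualAct ψ z ∈ I := by
    obtain ⟨φ, rfl⟩ := hz
    exact ⟨_, ((regular k H).dualAct_dualAct ψ φ t).symm⟩
  have one_mem : 1 ∈ I := by
    obtain ⟨n, v, g, h⟩ := exists_isDualBasis k H
    have := h.sum_antipode_mul_dualAct hS ((regular k H).dualAct β t)
    rw [counit_dualAct, hβ, one_smul] at this
    rw [← this]
    exact I.sum_mem fun s _ => mul_mem _ (dualAct_mem _ ⟨β, rfl⟩)
  exact fun x => mul_one x ▸ mul_mem x one_mem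

theorem IsFrobenius.injective_of_surjective {R : Type*} [Ring R] [Algebra k R]
    (hF : IsFrobenius k R) {g : Module.Dual k R →ₗ[k] R} (hg : Function.Surjective g) :
    Function.Injective g := by
  obtain ⟨_, -, e, -⟩ := hF
  have := OrzechProperty.injective_of_surjective_endomorphism (g ∘ₗ e.toLinearMap)
    (hg.comp e.surjective)
  exact (Function.Injective.of_comp_iff' g e.bijective).mp this

theorem isLeftCointegral_of_dualAct_eq_one [Module.Projective k H] {t : H}
    (ht : Function.Injective ((regular k H).dualAct.flip t)) {lam : Module.Dual k H}
    (hlam : (regular k H).dualAct lam t = 1) : IsLeftCointegral lam := by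
  intro h
  rw [← sub_eq_zero, ← Module.forall_dual_apply_eq_zero_iff k]
  intro ψ
  have : ψ ∘ₗ (regular k H).dualAct lam = ψ 1 • lam := ht <| by
    rw [LinearMap.flip_apply, ← dualAct_dualAct, hlam, dualAct_one, map_smul,
      LinearMap.flip_apply, hlam]
  rw [map_sub, map_smul, ← LinearMap.comp_apply, this, LinearMap.smul_apply, smul_eq_mul,
    smul_eq_mul, mul_comm, sub_self]

theorem IsFrobenius.exists_integrals (hF : IsFrobenius k H) (hS : IsInvolutory k H) :
    ∃ t ∈ leftIntegrals k H, ∃ lam : Module.Dual k H,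
      IsLeftCointegral lam ∧ (regular k H).dualAct lam t = 1 := by
  obtain ⟨t, ht, β, hβ⟩ := hF.exists_leftIntegral_apply_eq_one
  obtain ⟨_, _, -⟩ := id hF
  have hsurj := surjective_flip_dualAct hS ht hβ
  obtain ⟨lam, hlam⟩ := hsurj 1
  exact ⟨t, ht, lam,
    isLeftCointegral_of_dualAct_eq_one (hF.injective_of_surjective hsurj) hlam, hlam⟩

theorem comp_mulRight_eq_counit {t : H} (ht : t ∈ leftIntegrals k H) {lam : Module.Dual k H}
    (hlam : (regular k H).dualAct lam t = 1) :
    lam ∘ₗ LinearMap.mulRight k t = Coalgebra.counit := by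
  have hlt : lam t = 1 := by rw [← counit_dualAct, hlam, Bialgebra.counit_one]
  ext h
  simp [ht h, hlt]

theorem sum_apply_mul_right_smul_left {t : H} (ht : t ∈ leftIntegrals k H) {lam : Module.Dual k H}
    (hlam : (regular k H).dualAct lam t = 1) {ι : Type*} (r : Coalgebra.Repr k t ι) (x : H) :
    ∑ i ∈ r.index, lam (x * r.right i) • r.left i = antipode k x := by
  have := antipode_mul_dualAct ht lam x
  rw [hlam, mul_one, dualAct_eq_sum _ r] at this
  exact this.symm

theorem sum_apply_antipode_mul_mul {t : H} (ht : t ∈ leftIntegrals k H)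
    {lam : Module.Dual k H} (hlam : (regular k H).dualAct lam t = 1) {ι : Type*}
    (r : Coalgebra.Repr k t ι) (b : H) :
    ∑ i ∈ r.index, lam (antipode k (r.left i) * b * r.right i) =
      counit (R := k) t * lam (antipode k b) := by
  have expand := sum_apply_mul_right_smul_left ht hlam r
  calc ∑ i ∈ r.index, lam (antipode k (r.left i) * b * r.right i)
      = ∑ i ∈ r.index, ∑ j ∈ r.index,
          lam (r.left i * r.right j) * lam (r.left j * b * r.right i) := by
        refine Finset.sum_congr rfl fun i _ => ?_
        rw [← expand (r.left i)]
        simp [Finset.sum_mul]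
    _ = ∑ j ∈ r.index, lam (antipode k (r.left j * b) * r.right j) := by
        rw [Finset.sum_comm]
        refine Finset.sum_congr rfl fun j _ => ?_
        rw [← expand (r.left j * b)]
        simp [Finset.sum_mul, mul_comm]
    _ = lam (antipode k b * ∑ j ∈ r.index, antipode k (r.left j) * r.right j) := by
        simp [antipode_mul_antidistrib, Finset.mul_sum, mul_assoc]
    _ = counit (R := k) t * lam (antipode k b) := by
        rw [sum_antipode_mul_eq_smul]
        simp

end Integrals

namespace RightComoduleAlgebra

variable {k : Type*} [CommRing k] {H : Type*} [Ring H] [HopfAlgebra k H]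
  {B : Type*} [Ring B] [Algebra k B] (ρ : RightComoduleAlgebra k H B)

/-- The linear map `b ⊗ h ↦ ρ(b) (1 ⊗ S(h))`, which intertwines the two canonical maps. -/
noncomputable def twist : B ⊗[k] H →ₗ[k] B ⊗[k] H :=
  lift ((LinearMap.mul k (B ⊗[k] H)).compl₁₂ ρ.coaction.toLinearMap
    ((Algebra.TensorProduct.includeRight : H →ₐ[k] B ⊗[k] H).toLinearMap ∘ₗ antipode k))

theorem twist_tmul (b : B) (h : H) :
    ρ.twist (b ⊗ₜ h) = ρ.coaction b * ((1 : B) ⊗ₜ[k] antipode k h) := rfl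

theorem twist_tmul_one_mul (b : B) (X : B ⊗[k] H) :
    ρ.twist ((b ⊗ₜ[k] (1 : H)) * X) = ρ.coaction b * ρ.twist X := by
  induction X with
  | zero => simp
  | tmul x y => simp [twist_tmul, mul_assoc]
  | add x y hx hy => simp only [mul_add, map_add, hx, hy]

theorem twist_coaction (b : B) : ρ.twist (ρ.coaction b) = b ⊗ₜ[k] (1 : H) := by
  have hmul (X : B ⊗[k] H) (h : H) : X * ((1 : B) ⊗ₜ[k] antipode k h) =
      (LinearMap.mul' k H ∘ₗ (antipode k).lTensor H).lTensor B
        (TensorProduct.assoc k B H H (X ⊗ₜ h)) := by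
    induction X with
    | zero => simp
    | tmul x y => simp
    | add x y hx hy => rw [add_mul, hx, hy, add_tmul, map_add, map_add]
  have htwist : ρ.twist = (LinearMap.mul' k H ∘ₗ (antipode k).lTensor H).lTensor B ∘ₗ
      (TensorProduct.assoc k B H H).toLinearMap ∘ₗ ρ.coaction.toLinearMap.rTensor H := by
    ext
    simp [twist_tmul, hmul]
  rw [htwist, LinearMap.comp_apply, LinearMap.comp_apply, LinearEquiv.coe_coe,
    lTensor_assoc_rTensor_coaction, LinearMap.comp_assoc, mul_antipode_lTensor_comul,
    LinearMap.lTensor_comp_apply, ρ.counit]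
  simp

theorem twist_preCanLeft (T : B ⊗[k] B) : ρ.twist (ρ.preCanLeft T) = ρ.preCanRight T := by
  induction T with
  | zero => simp
  | tmul b c => rw [preCanLeft_tmul, preCanRight_tmul, twist_tmul_one_mul, twist_coaction]
  | add x y hx hy => simp only [map_add, hx, hy]

theorem preCanRight_lTensor_mulRight (T : B ⊗[k] B) (b : B) :
    ρ.preCanRight ((LinearMap.mulRight k b).lTensor B T) =
      ρ.preCanRight T * (b ⊗ₜ[k] (1 : H)) := by
  induction T with
  | zero => simp
  | tmul x y => simp [preCanRight_tmul, mul_assoc]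
  | add x y hx hy => simp only [map_add, add_mul, hx, hy]

variable {ρ}

theorem surjective_canLeft_iff :
    Function.Surjective ρ.canLeft ↔ Function.Surjective ρ.preCanLeft :=
  ((Submodule.mkQ_surjective _).of_comp_iff ρ.canLeft).symm

theorem surjective_canRight_iff :
    Function.Surjective ρ.canRight ↔ Function.Surjective ρ.preCanRight :=
  ((Submodule.mkQ_surjective _).of_comp_iff ρ.canRight).symm

theorem surjective_canRight_of_surjective_canLeft (hS : IsInvolutory k H)
    (hcan : Function.Surjective ρ.canLeft) : Function.Surjective ρ.canRight := by
  rw [surjective_canLeft_iff] at hcan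
  rw [surjective_canRight_iff, ← LinearMap.range_eq_top, eq_top_iff,
    ← TensorProduct.span_tmul_eq_top, Submodule.span_le]
  rintro _ ⟨b, h, rfl⟩
  obtain ⟨T, hT⟩ := hcan (1 ⊗ₜ antipode k h)
  refine ⟨(LinearMap.mulRight k b).lTensor B T, ?_⟩
  rw [preCanRight_lTensor_mulRight, ← twist_preCanLeft, hT, twist_tmul, hS]
  simp

theorem IsGaloisExtension.surjective_canRight (hG : ρ.IsGaloisExtension)
    (hS : IsInvolutory k H) : Function.Surjective ρ.canRight :=
  hG.elim (fun h => surjective_canRight_of_surjective_canLeft hS h.surjective) (·.surjective)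

theorem exists_sum_coaction_mul_tmul_one (hcan : Function.Surjective ρ.canRight)
    (X : B ⊗[k] H) :
    ∃ (n : ℕ) (l r : Fin n → B), ∑ i, ρ.coaction (l i) * (r i ⊗ₜ[k] (1 : H)) = X := by
  obtain ⟨T, rfl⟩ := surjective_canRight_iff.mp hcan X
  obtain ⟨n, l, r, rfl⟩ := TensorProduct.exists_sum_tmul_eq T
  exact ⟨n, l, r, by simp [preCanRight_tmul]⟩

variable (ρ)

theorem dualAct_mem_coinvariants {lam : Module.Dual k H} (hlam : IsLeftCointegral lam) (b : B) :
    ρ.dualAct lam b ∈ ρ.coinvariants := by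
  have hlam' : (regular k H).dualAct lam = lam.smulRight 1 := LinearMap.ext hlam
  rw [mem_coinvariants, coaction_dualAct, hlam', lTensor_smulRight, dualAct_apply]

/-- The conditional expectation `b ↦ ∑ lam(b₁) b₀` onto the coinvariants, defined by a left
cointegral `lam`. -/
noncomputable def expectation {lam : Module.Dual k H} (hlam : IsLeftCointegral lam) :
    B →ₗ[ρ.coinvariants] ρ.coinvariants where
  toFun b := ⟨ρ.dualAct lam b, ρ.dualAct_mem_coinvariants hlam b⟩
  map_add' x y := Subtype.ext (map_add _ x y)
  map_smul' a b := Subtype.ext <| by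
    have ha : ρ.coaction a = (a : B) ⊗ₜ[k] (1 : H) := a.2
    simp [Subalgebra.smul_def, dualAct_apply, ha, slice_tmul_mul]

@[simp]
theorem coe_expectation {lam : Module.Dual k H} (hlam : IsLeftCointegral lam) (b : B) :
    (ρ.expectation hlam b : B) = ρ.dualAct lam b := rfl

theorem sum_expectation_smul {t : H} {lam : Module.Dual k H} {ι : Type*} [Fintype ι] {l r : ι → B}
    (ht : t ∈ leftIntegrals k H) (hlam : IsLeftCointegral lam)
    (hlt : (regular k H).dualAct lam t = 1)
    (hlr : ∑ i, ρ.coaction (l i) * (r i ⊗ₜ[k] (1 : H)) = (1 : B) ⊗ₜ[k] t) (b : B) :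
    ∑ i, ρ.expectation hlam (b * l i) • r i = b := by
  calc ∑ i, ρ.expectation hlam (b * l i) • r i
    _ = slice lam (ρ.coaction b * ∑ i, ρ.coaction (l i) * (r i ⊗ₜ[k] (1 : H))) := by
      simp [Subalgebra.smul_def, dualAct_apply, Finset.mul_sum, ← mul_assoc,
        slice_mul_tmul]
    _ = ρ.dualAct Coalgebra.counit b := by
      rw [hlr, slice_mul_tmul, mul_one, comp_mulRight_eq_counit ht hlt, dualAct_apply]
    _ = b := ρ.dualAct_counit b

/-- The linear map `x ⊗ v ↦ ∑ x₀ ⊗ S(v₁) x₁ ⊗ v₂`. -/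
noncomputable def unwind : B ⊗[k] H →ₗ[k] B ⊗[k] (H ⊗[k] H) :=
  lift ((LinearMap.mul k (B ⊗[k] (H ⊗[k] H))).compl₁₂
    ((Algebra.TensorProduct.includeRight : H ⊗[k] H →ₐ[k] B ⊗[k] (H ⊗[k] H)).toLinearMap ∘ₗ
      (antipode k).rTensor H ∘ₗ (comul : H →ₗ[k] H ⊗[k] H))
    ((leg12 k H B).comp ρ.coaction).toLinearMap).flip

theorem unwind_tmul (x : B) (v : H) : ρ.unwind (x ⊗ₜ v) =
    ((1 : B) ⊗ₜ[k] (antipode k).rTensor H (comul (R := k) v)) * leg12 k H B (ρ.coaction x) := rfl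

theorem unwind_mul_tmul_one (X : B ⊗[k] H) (b : B) :
    ρ.unwind (X * (b ⊗ₜ[k] (1 : H))) = ρ.unwind X * leg12 k H B (ρ.coaction b) := by
  induction X with
  | zero => simp
  | tmul x y => simp [unwind_tmul, mul_assoc]
  | add x y hx hy => simp only [add_mul, map_add, hx, hy]

theorem unwind_coaction (hS : IsInvolutory k H) (b : B) :
    ρ.unwind (ρ.coaction b) = leg13 k H B (ρ.coaction b) := by
  have hmul (v : H) (X : B ⊗[k] H) :
      ((1 : B) ⊗ₜ[k] (antipode k).rTensor H (comul (R := k) v)) * leg12 k H B X =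
        (antipodeComulMul k H).lTensor B (TensorProduct.assoc k B H H (X ⊗ₜ v)) := by
    induction X with
    | zero => simp
    | tmul x y => simp [antipodeComulMul_tmul]
    | add x y hx hy => rw [map_add, mul_add, hx, hy, add_tmul, map_add, map_add]
  have hunwind : ρ.unwind = (antipodeComulMul k H).lTensor B ∘ₗ
      (TensorProduct.assoc k B H H).toLinearMap ∘ₗ ρ.coaction.toLinearMap.rTensor H := by
    ext
    simp [unwind_tmul, hmul]
  have hcomul : antipodeComulMul k H ∘ₗ comul = TensorProduct.mk k H H 1 :=
    LinearMap.ext (antipodeComulMul_comul hS)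
  rw [hunwind, LinearMap.comp_apply, LinearMap.comp_apply, LinearEquiv.coe_coe,
    lTensor_assoc_rTensor_coaction, hcomul]
  rfl

theorem sum_leg13_mul_leg12 (hS : IsInvolutory k H) {t : H} {ι : Type*} [Fintype ι] {l r : ι → B}
    (hlr : ∑ i, ρ.coaction (l i) * (r i ⊗ₜ[k] (1 : H)) = (1 : B) ⊗ₜ[k] t) :
    ∑ i, leg13 k H B (ρ.coaction (l i)) * leg12 k H B (ρ.coaction (r i)) =
      (1 : B) ⊗ₜ[k] (antipode k).rTensor H (comul (R := k) t) := by
  have := congrArg ρ.unwind hlr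
  rw [unwind_tmul, map_one, map_one, mul_one] at this
  simpa only [map_sum, unwind_mul_tmul_one, unwind_coaction _ hS] using this

end RightComoduleAlgebra

section TraceForm

open RightComoduleAlgebra

variable {k : Type*} [CommRing k] {H : Type*} [Ring H] [HopfAlgebra k H]
  {B : Type*} [Ring B] [Algebra k B] {f : B →ₗ[k] k}

theorem IsTraceForm.apply_sum_dualAct (hf : IsTraceForm f) (ρ : RightComoduleAlgebra k H B)
    (hS : IsInvolutory k H) {t : H} (ht : t ∈ leftIntegrals k H) {lam : Module.Dual k H}
    (hlt : (regular k H).dualAct lam t = 1) {ι : Type*} [Fintype ι] {l r : ι → B}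
    (hlr : ∑ i, ρ.coaction (l i) * (r i ⊗ₜ[k] (1 : H)) = (1 : B) ⊗ₜ[k] t) (b : B) :
    f (∑ i, ρ.dualAct lam (r i * b * l i)) =
      Coalgebra.counit (R := k) t * f (ρ.dualAct (lam ∘ₗ antipode k) b) := by
  simp only [dualAct_apply, map_mul]
  induction ρ.coaction b with
  | zero => simp
  | tmul p q =>
    let s := Coalgebra.Repr.arbitrary k t
    have hs := sum_apply_antipode_mul_mul ht hlt s q
    simp only [map_sum, hf.apply_slice_mul_tmul_mul]
    rw [← map_sum, ρ.sum_leg13_mul_leg12 hS hlr, ← s.eq]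
    simp [tmul_sum, ← Finset.mul_sum, hs]
    ring
  | add x y hx hy =>
    simp only [add_mul, mul_add, map_add, Finset.sum_add_distrib] at hx hy ⊢
    rw [hx, hy]

end TraceForm

end HopfGalois

open HopfGalois HopfAlgebra in
theorem theorem3p7_general
    {k : Type*} [CommRing k] {H : Type*} [Ring H] [HopfAlgebra k H]
    {B : Type*} [Ring B] [Algebra k B] (ρ : RightComoduleAlgebra k H B)
    (hcan : Function.Surjective ρ.canRight) (hInv : IsInvolutory k H) (hFrob : IsFrobenius k H)
    [IsMulCommutative ρ.coinvariants]
    (M : Type*) [AddCommGroup M] [Module B M] [Module.Finite B M] [Module.Projective B M] :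
    Module.Finite ρ.coinvariants M ∧ Module.Projective ρ.coinvariants M ∧
      ∃ a : ρ.coinvariants, IsRankElement ρ.coinvariants M a ∧
        ∀ f : B →ₗ[k] k, IsTraceForm f → f a ∈ integralIdeal k H := by
  obtain ⟨t, ht, lam, hlam, hlt⟩ := hFrob.exists_integrals hInv
  obtain ⟨n, l, r, hlr⟩ :=
    RightComoduleAlgebra.exists_sum_coaction_mul_tmul_one hcan (1 ⊗ₜ t)
  obtain ⟨N, u, φ, hu⟩ := exists_isDualBasis B M
  have huA := hu.restrictScalars _ (ρ.sum_expectation_smul ht hlam hlt hlr)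
  refine ⟨huA.finite, huA.projective, _, huA.isRankElement, fun f hf => ?_⟩
  have htr := hf.apply_sum_dualAct ρ hInv ht hlt hlr (∑ j, φ j (u j))
  have hsum : ((∑ s : Fin N × Fin n, ρ.expectation hlam (φ s.1 (r s.2 • u s.1) * l s.2) :
      ρ.coinvariants) : B) = ∑ i, ρ.dualAct lam (r i * (∑ j, φ j (u j)) * l i) := by
    simp [Fintype.sum_prod_type_right, Finset.mul_sum, Finset.sum_mul]
  rw [← hsum] at htr
  rw [integralIdeal_eq_left k H hInv]
  refine ⟨f (ρ.dualAct (lam ∘ₗ antipode k) (∑ j, φ j (u j))) • t, Submodule.smul_mem _ _ ht, ?_⟩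
  rw [map_smul, smul_eq_mul, mul_comm]
  exact htr.symm

theorem theorem3p7
    {k : Type*} [CommRing k]
    {H : Type*} [Ring H] [HopfAlgebra k H]
    {B : Type*} [Ring B] [Algebra k B]
    (ρ : HopfGalois.RightComoduleAlgebra k H B)
    (hGalois : ρ.IsGaloisExtension)
    (hInv : HopfGalois.IsInvolutory k H)
    (hFrob : HopfGalois.IsFrobenius k H)
    [IsMulCommutative ρ.coinvariants]
    (hIdem : ∀ e : ρ.coinvariants, IsIdempotentElem e → e = 0 ∨ e = 1)
    (hTrace : ∃ f : B →ₗ[k] k, HopfGalois.IsTraceForm f ∧ f 1 = 1)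
    (M : Type*) [AddCommGroup M] [Module B M] [Module.Finite B M] [Module.Projective B M] :
    ∃ n : ℕ, HopfGalois.HasConstantRank ρ.coinvariants M n ∧
      (n : k) ∈ HopfGalois.integralIdeal k H := by
  obtain ⟨f, hf, hf1⟩ := hTrace
  obtain ⟨_, _, a, ha, hmem⟩ := theorem3p7_general ρ
    (hGalois.surjective_canRight hInv) hInv hFrob M
  obtain ⟨n, rfl, hn⟩ := ha.exists_hasConstantRank hIdem
  have hfn : f (n : ρ.coinvariants) = n := by
    rw [SubringClass.coe_natCast, ← nsmul_one, map_nsmul, hf1, nsmul_one]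
  exact ⟨n, hn, hfn ▸ hmem f hf⟩
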